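/- Let $(M,g,J)$ be a Kähler manifold with Ricci form $\rho(X,Y)=\mathrm{Ric}(JX,Y)$, let $\sharp:T^*M\to TM$ be the metric isomorphism, and let $I\subseteq\mathbb{R}$ be a nondegenerate interval. For $\lambda\in\mathbb{R}$, a smooth curve $\alpha:I\to M$ is called *Ricci magnetic geodesic with parameter $\lambda$* (RMG$_\lambda$) if $$\nabla^{\alpha}_{d/dt}\dot\alpha=\lambda\,\sharp\,\iota_{\dot\alpha}\rho\qquad\text{on } I,$$ where $\nabla^\alpha$ is the pullback to $\alpha^{-1}TM$ of the Levi-Civita connection of $g$ and $\iota$ is the interior product. **Proposition.** Let $M$ and $N$ be Kähler manifolds and let $\varphi:M\to N$ be a holomorphic local isometry, that is, a holomorphic map whose differential $\mathrm{d}\varphi_x:T_xM\to T_{\varphi(x)}N$ is a linear isometry onto $T_{\varphi(x)}N$ for every $x\in M$. If $\lambda\in\mathbb{R}$ and $\alpha:I\to M$ is an RMG$_\lambda$ curve on $M$, then $\varphi\circ\alpha$ is an RMG$_\lambda$ curve on $N$. -/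

import Mathlib

open scoped Manifold ContDiff

set_option maxSynthPendingDepth 3

noncomputable section

namespace RMG

/-! ## Pseudo-Riemannian geometry of a metric on (an open part of) a vector space

Here `G` is a field of bilinear forms on `E`, the coefficients of a metric in a chart. -/

section Local

variable {E : Type*} [NormedAddCommGroup E] [NormedSpace ℝ E]

/-- The Christoffel form of the first kind,
`(u, v, w) ↦ (D_u G (v, w) + D_v G (u, w) - D_w G (u, v)) / 2`, at the point `y`. -/
def christoffelFirst (G : E → E →L[ℝ] E →L[ℝ] ℝ) (y : E) : E →L[ℝ] E →L[ℝ] E →L[ℝ] ℝ :=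
  let D : E →L[ℝ] E →L[ℝ] E →L[ℝ] ℝ := fderiv ℝ G y
  let T : E →L[ℝ] E →L[ℝ] E →L[ℝ] ℝ :=
    (ContinuousLinearMap.flipₗᵢ ℝ E E ℝ).toContinuousLinearEquiv.toContinuousLinearMap ∘L D.flip
  (1 / 2 : ℝ) • (D + D.flip - T)

theorem christoffelFirst_apply (G : E → E →L[ℝ] E →L[ℝ] ℝ) (y u v w : E) :
    christoffelFirst G y u v w =
      (1 / 2) * (fderiv ℝ G y u v w + fderiv ℝ G y v u w - fderiv ℝ G y w u v) := by
  simp [christoffelFirst]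

/-- The Christoffel symbols of the Levi-Civita connection of `G`: `Γ(u, v)` is the vector with
`G (Γ(u, v), w) = christoffelFirst G y u v w` for all `w`. (The form `G y`, seen as a linear map
from `E` to its dual, is inverted.) -/
def christoffel (G : E → E →L[ℝ] E →L[ℝ] ℝ) (y : E) : E →L[ℝ] E →L[ℝ] E :=
  (ContinuousLinearMap.compL ℝ E (E →L[ℝ] ℝ) E (G y).inverse) ∘L christoffelFirst G y

theorem christoffel_apply (G : E → E →L[ℝ] E →L[ℝ] ℝ) (y u v : E) :
    christoffel G y u v = (G y).inverse (christoffelFirst G y u v) := rfl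

/-- The curvature of `G` at `y`: `curvature G y v w` is the endomorphism `u ↦ R(u, v) w`, where
`R(u, v) = [∇_u, ∇_v] - ∇_[u, v]`. -/
def curvature (G : E → E →L[ℝ] E →L[ℝ] ℝ) (y v w : E) : E →L[ℝ] E :=
  ((fderiv ℝ (christoffel G) y).flip v).flip w - (fderiv ℝ (christoffel G) y v).flip w
    + (christoffel G y).flip (christoffel G y v w)
    - (christoffel G y v) ∘L ((christoffel G y).flip w)

theorem curvature_apply (G : E → E →L[ℝ] E →L[ℝ] ℝ) (y u v w : E) :
    curvature G y v w u =
      fderiv ℝ (christoffel G) y u v w - fderiv ℝ (christoffel G) y v u w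
        + christoffel G y u (christoffel G y v w) - christoffel G y v (christoffel G y u w) := by
  simp [curvature]

/-- The Ricci tensor of `G` at `y`: `Ric(v, w)` is the trace of `u ↦ R(u, v) w`. -/
def ricci [FiniteDimensional ℝ E] (G : E → E →L[ℝ] E →L[ℝ] ℝ) (y : E) : E →L[ℝ] E →L[ℝ] ℝ :=
  LinearMap.toContinuousBilinearMap <| LinearMap.mk₂ ℝ
    (fun v w ↦ LinearMap.trace ℝ E (curvature G y v w : E →ₗ[ℝ] E))
    (fun v₁ v₂ w ↦ by
      rw [← map_add]; congr 1; ext u; simp [curvature_apply]; abel)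
    (fun c v w ↦ by
      rw [← map_smul]; congr 1; ext u; simp [curvature_apply, smul_sub, smul_add])
    (fun v w₁ w₂ ↦ by
      rw [← map_add]; congr 1; ext u; simp [curvature_apply]; abel)
    (fun c v w ↦ by
      rw [← map_smul]; congr 1; ext u; simp [curvature_apply, smul_sub, smul_add])

theorem ricci_apply [FiniteDimensional ℝ E] (G : E → E →L[ℝ] E →L[ℝ] ℝ) (y v w : E) :
    ricci G y v w = LinearMap.trace ℝ E (curvature G y v w : E →ₗ[ℝ] E) := rfl

end Local

/-! ## Kähler manifolds

A complex manifold is a space `M` with a holomorphic atlas: charts in a complex vector space `E`,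
`IsManifold 𝓘(ℂ, E) ω M`. The underlying real manifold has the same charts, with model
`𝓘(ℝ, E)`, and its tangent spaces are `TangentSpace 𝓘(ℝ, E) x`. -/

section Kahler

variable {E : Type*} [NormedAddCommGroup E] [NormedSpace ℂ E]
  {M : Type*} [TopologicalSpace M] [ChartedSpace E M]

/-- A complex manifold is a real-analytic manifold. -/
instance isManifold_real [IsManifold 𝓘(ℂ, E) ω M] : IsManifold 𝓘(ℝ, E) ω M := by
  refine isManifold_of_contDiffOn 𝓘(ℝ, E) ω M fun e e' he he' ↦ ?_
  have h := (contDiffGroupoid ω 𝓘(ℂ, E)).compatible he he'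
  rw [contDiffGroupoid, mem_groupoid_of_pregroupoid] at h
  exact h.1.restrict_scalars ℝ

/-- The complex structure `J` of a complex manifold, on the real tangent space at `x`:
multiplication by `i`. The tangent space is identified with `E` by the differential of the
preferred chart at `x`; any other chart of the atlas gives the same `J`, since the coordinate
changes are holomorphic. -/
def complexStructure (x : M) : TangentSpace 𝓘(ℝ, E) x →L[ℝ] TangentSpace 𝓘(ℝ, E) x :=
  (Complex.I • ContinuousLinearMap.id ℝ E : E →L[ℝ] E)

/-- The differential at `x` of the preferred chart at `x`, a map from `T_x M` (which is a copy
of `E`) to `E`. -/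
def chartDifferential (x : M) : E →L[ℝ] E :=
  (mfderiv 𝓘(ℝ, E) 𝓘(ℝ, E) (extChartAt 𝓘(ℝ, E) x) x :
    TangentSpace 𝓘(ℝ, E) x →L[ℝ] TangentSpace 𝓘(ℝ, E) (extChartAt 𝓘(ℝ, E) x x))

/-- The differential at `y : E` of the inverse of the preferred chart at `p`, a map from `E` to
the tangent space of `M` (which is a copy of `E`) at the point with coordinates `y`. -/
def inverseChartDifferential (p : M) (y : E) : E →L[ℝ] E :=
  (mfderiv 𝓘(ℝ, E) 𝓘(ℝ, E) (extChartAt 𝓘(ℝ, E) p).symm y :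
    TangentSpace 𝓘(ℝ, E) y →L[ℝ] TangentSpace 𝓘(ℝ, E) ((extChartAt 𝓘(ℝ, E) p).symm y))

/-- The coefficients, in the preferred chart at `p`, of a field `T` of bilinear forms on the
tangent spaces of `M`: its pullback by the inverse of the chart. -/
def chartPullback
    (T : ∀ x : M, TangentSpace 𝓘(ℝ, E) x →L[ℝ] TangentSpace 𝓘(ℝ, E) x →L[ℝ] ℝ)
    (p : M) (y : E) : E →L[ℝ] E →L[ℝ] ℝ :=
  let B : E →L[ℝ] E →L[ℝ] ℝ := T ((extChartAt 𝓘(ℝ, E) p).symm y)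
  B.bilinearComp (inverseChartDifferential p y) (inverseChartDifferential p y)

theorem chartPullback_apply
    (T : ∀ x : M, TangentSpace 𝓘(ℝ, E) x →L[ℝ] TangentSpace 𝓘(ℝ, E) x →L[ℝ] ℝ)
    (p : M) (y u v : E) :
    chartPullback T p y u v = T ((extChartAt 𝓘(ℝ, E) p).symm y)
      (mfderiv 𝓘(ℝ, E) 𝓘(ℝ, E) (extChartAt 𝓘(ℝ, E) p).symm y u)
      (mfderiv 𝓘(ℝ, E) 𝓘(ℝ, E) (extChartAt 𝓘(ℝ, E) p).symm y v) := rfl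

variable (E M) in
/-- A Kähler metric on the complex manifold `M`: a smooth Riemannian metric `g` which is
`J`-invariant and whose fundamental form `ω = g(J ·, ·)` is closed. Closedness is written out in
the charts of `M`: `D_u ω(v, w) + D_v ω(w, u) + D_w ω(u, v) = 0`. -/
structure KahlerMetric [IsManifold 𝓘(ℂ, E) ω M] extends
    Bundle.ContMDiffRiemannianMetric 𝓘(ℝ, E) ∞ E (fun x : M ↦ TangentSpace 𝓘(ℝ, E) x) where
  hermitian : ∀ (x : M) (v w : TangentSpace 𝓘(ℝ, E) x),
    inner x (complexStructure x v) (complexStructure x w) = inner x v w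
  closed : ∀ (p : M), ∀ y ∈ (extChartAt 𝓘(ℝ, E) p).target, ∀ u v w : E,
    fderiv ℝ (chartPullback (fun x : M ↦ inner x ∘L complexStructure x) p) y u v w
      + fderiv ℝ (chartPullback (fun x : M ↦ inner x ∘L complexStructure x) p) y v w u
      + fderiv ℝ (chartPullback (fun x : M ↦ inner x ∘L complexStructure x) p) y w u v = 0

variable [IsManifold 𝓘(ℂ, E) ω M]

/-- The Ricci tensor of a Kähler metric at `x`, computed in the preferred chart at `x`. -/
def KahlerMetric.ricciTensor [FiniteDimensional ℝ E] (g : KahlerMetric E M) (x : M) :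
    TangentSpace 𝓘(ℝ, E) x →L[ℝ] TangentSpace 𝓘(ℝ, E) x →L[ℝ] ℝ :=
  (ricci (chartPullback g.inner x) (extChartAt 𝓘(ℝ, E) x x)).bilinearComp
    (chartDifferential x) (chartDifferential x)

theorem KahlerMetric.ricciTensor_apply [FiniteDimensional ℝ E] (g : KahlerMetric E M) (x : M)
    (v w : TangentSpace 𝓘(ℝ, E) x) :
    g.ricciTensor x v w = ricci (chartPullback g.inner x) (extChartAt 𝓘(ℝ, E) x x)
      (mfderiv 𝓘(ℝ, E) 𝓘(ℝ, E) (extChartAt 𝓘(ℝ, E) x) x v)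
      (mfderiv 𝓘(ℝ, E) 𝓘(ℝ, E) (extChartAt 𝓘(ℝ, E) x) x w) := rfl

/-- The Ricci form `ρ(X, Y) = Ric(J X, Y)`. -/
def KahlerMetric.ricciForm [FiniteDimensional ℝ E] (g : KahlerMetric E M) (x : M) :
    TangentSpace 𝓘(ℝ, E) x →L[ℝ] TangentSpace 𝓘(ℝ, E) x →L[ℝ] ℝ :=
  g.ricciTensor x ∘L complexStructure x

/-- The metric isomorphism `♯ : T*_x M → T_x M`, the inverse of `v ↦ g(v, ·)`. -/
def KahlerMetric.sharp (g : KahlerMetric E M) (x : M) :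
    (TangentSpace 𝓘(ℝ, E) x →L[ℝ] ℝ) →L[ℝ] TangentSpace 𝓘(ℝ, E) x :=
  let B : E →L[ℝ] E →L[ℝ] ℝ := g.inner x
  B.inverse

/-- The velocity at time `t` of a curve `α` defined on the interval `S` (one-sided at an end point
of `S` that belongs to `S`). -/
def velocity (S : Set ℝ) (α : ℝ → M) (t : ℝ) : TangentSpace 𝓘(ℝ, E) (α t) :=
  mfderivWithin 𝓘(ℝ, ℝ) 𝓘(ℝ, E) α S t (1 : ℝ)

/-- The covariant derivative of the velocity along a curve `α` defined on the interval `S`, at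
time `t`. If `c` is `α` read in the preferred chart at `α t`, it is the tangent vector with
coordinates `c'' + Γ(c', c')`. -/
def KahlerMetric.covariantAcceleration (g : KahlerMetric E M) (S : Set ℝ) (α : ℝ → M) (t : ℝ) :
    TangentSpace 𝓘(ℝ, E) (α t) :=
  let c : ℝ → E := fun s ↦ extChartAt 𝓘(ℝ, E) (α t) (α s)
  let a : E := derivWithin (derivWithin c S) S t
    + christoffel (chartPullback g.inner (α t)) (c t) (derivWithin c S t) (derivWithin c S t)
  (chartDifferential (E := E) (α t)).inverse a

/-- The curve `α`, defined on the interval `S`, is Ricci magnetic geodesic with parameter `l`: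
it is smooth and `∇_{d/dt} α' = l ♯ ι_{α'} ρ` on `S`. -/
structure IsRMG [FiniteDimensional ℝ E] (g : KahlerMetric E M) (l : ℝ) (S : Set ℝ) (α : ℝ → M) :
    Prop where
  smooth : ContMDiffOn 𝓘(ℝ, ℝ) 𝓘(ℝ, E) ∞ α S
  equation : ∀ t ∈ S, g.covariantAcceleration S α t =
    l • g.sharp (α t) (g.ricciForm (α t) (velocity S α t))

variable {F : Type*} [NormedAddCommGroup F] [NormedSpace ℂ F]
  {N : Type*} [TopologicalSpace N] [ChartedSpace F N] [IsManifold 𝓘(ℂ, F) ω N]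

/-- A local isometry: a smooth map whose differential at each point is a linear isometry onto the
tangent space of the target. -/
structure IsLocalIsometry (g : KahlerMetric E M) (h : KahlerMetric F N) (f : M → N) : Prop where
  smooth : ContMDiff 𝓘(ℝ, E) 𝓘(ℝ, F) ∞ f
  bijective : ∀ x : M, Function.Bijective (mfderiv 𝓘(ℝ, E) 𝓘(ℝ, F) f x)
  isometric : ∀ (x : M) (v w : TangentSpace 𝓘(ℝ, E) x),
    h.inner (f x) (mfderiv 𝓘(ℝ, E) 𝓘(ℝ, F) f x v) (mfderiv 𝓘(ℝ, E) 𝓘(ℝ, F) f x w) =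
      g.inner x v w

end Kahler

end RMG

end

namespace RMG

open Filter Topology Bundle

/-! ### Metrics on vector spaces: Christoffel symbols, curvature and curves under a change of
coordinates. -/

section Local

variable {E : Type*} [NormedAddCommGroup E] [NormedSpace ℝ E]
  {F : Type*} [NormedAddCommGroup F] [NormedSpace ℝ F]

/-! Every ingredient of the equation (Levi-Civita connection, Ricci tensor, `J`, `♯`) is natural
under holomorphic local isometries, so `dφ` carries each side for `α` to the same side for `φ ∘ α`.

Let `ψ` be the map read in the preferred charts at `x` and its image. The isometry condition becomes
`G = ψ^*H` near the centre (`IsLocalIsometry.chartPullback_eq`). Differentiating it once gives `dψ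
Γ_G(u, v) = D²ψ(u, v) + Γ_H(dψ u, dψ v)` (`map_christoffel`). The term `D²ψ` is the one that appears
in `(ψ ∘ c)''`, whence `map_covariantAcceleration`. Differentiating the rule again and
antisymmetrizing removes the higher derivatives of `ψ` (`map_curvature`); a trace then gives the
Ricci tensor (`map_ricci`). Holomorphy gives `dφ J = J dφ`, hence the Ricci form, and duality
handles `♯` (`map_sharp`). -/

theorem apply_christoffel {G : E → E →L[ℝ] E →L[ℝ] ℝ} {y : E} (hG : (G y).IsInvertible)
    (u v : E) : G y (christoffel G y u v) = christoffelFirst G y u v := by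
  rw [christoffel_apply]
  exact hG.self_apply_inverse _

/-- Torsion-freeness: each derivative of `G` inherits the symmetry of `G`, and exchanging `u` and
`v` swaps the first two terms and fixes the third. -/
theorem christoffelFirst_symm {G : E → E →L[ℝ] E →L[ℝ] ℝ} {y : E}
    (hG : DifferentiableAt ℝ G y) (hs : ∀ z u v, G z u v = G z v u) (u v : E) :
    christoffelFirst G y u v = christoffelFirst G y v u := by
  have key (a b c : E) : fderiv ℝ G y a b c = fderiv ℝ G y a c b := by
    have h (b c : E) : HasFDerivAt (fun z ↦ G z b c)
        (((fderiv ℝ G y).flip b).flip c) y := by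
      have := (hG.hasFDerivAt.clm_apply (hasFDerivAt_const b y)).clm_apply (hasFDerivAt_const c y)
      refine this.congr_fderiv ?_
      ext; simp
    have e : (fun z ↦ G z b c) = fun z ↦ G z c b := funext fun z ↦ hs z b c
    have h1 := h b c
    rw [e] at h1
    simpa using congrArg (fun L : E →L[ℝ] ℝ ↦ L a) (h1.unique (h c b))
  ext w
  simp only [christoffelFirst_apply, key w v u]
  ring

theorem christoffel_symm {G : E → E →L[ℝ] E →L[ℝ] ℝ} {y : E}
    (hG : DifferentiableAt ℝ G y) (hs : ∀ z u v, G z u v = G z v u) (u v : E) :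
    christoffel G y u v = christoffel G y v u := by
  rw [christoffel_apply, christoffel_apply, christoffelFirst_symm hG hs]

/-- The derivative of a pulled-back metric. -/
theorem fderiv_pullback_metric {G : E → E →L[ℝ] E →L[ℝ] ℝ} {H : F → F →L[ℝ] F →L[ℝ] ℝ}
    {ψ : E → F} {y : E} (hG : DifferentiableAt ℝ G y) (hH : DifferentiableAt ℝ H (ψ y))
    (hψ : DifferentiableAt ℝ ψ y) (hψ' : DifferentiableAt ℝ (fderiv ℝ ψ) y)
    (hGH : ∀ᶠ z in 𝓝 y, ∀ u v, G z u v = H (ψ z) (fderiv ℝ ψ z u) (fderiv ℝ ψ z v)) (z u v : E) :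
    fderiv ℝ G y z u v =
      fderiv ℝ H (ψ y) (fderiv ℝ ψ y z) (fderiv ℝ ψ y u) (fderiv ℝ ψ y v)
        + H (ψ y) (fderiv ℝ (fderiv ℝ ψ) y z u) (fderiv ℝ ψ y v)
        + H (ψ y) (fderiv ℝ ψ y u) (fderiv ℝ (fderiv ℝ ψ) y z v) := by
  have h1 := (hG.hasFDerivAt.clm_apply (hasFDerivAt_const u y)).clm_apply (hasFDerivAt_const v y)
  have hD (u : E) := hψ'.hasFDerivAt.clm_apply (hasFDerivAt_const u y)
  have h2 := ((hH.hasFDerivAt.comp y hψ.hasFDerivAt).clm_apply (hD u)).clm_apply (hD v)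
  have h3 := h1.unique (h2.congr_of_eventuallyEq (hGH.mono fun z hz ↦ hz u v))
  have h4 := congrArg (fun L : E →L[ℝ] ℝ ↦ L z) h3
  simp at h4
  rw [h4]
  ring

/-- The transformation rule of the Christoffel symbols under a local isometry. -/
theorem map_christoffel {G : E → E →L[ℝ] E →L[ℝ] ℝ} {H : F → F →L[ℝ] F →L[ℝ] ℝ}
    {ψ : E → F} {y : E} (hG : DifferentiableAt ℝ G y) (hH : DifferentiableAt ℝ H (ψ y))
    (hψ : ContDiffAt ℝ 2 ψ y) (hGi : (G y).IsInvertible) (hHi : (H (ψ y)).IsInvertible)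
    (hHs : ∀ u v, H (ψ y) u v = H (ψ y) v u)
    (hs : Function.Surjective (fderiv ℝ ψ y))
    (hGH : ∀ᶠ z in 𝓝 y, ∀ u v, G z u v = H (ψ z) (fderiv ℝ ψ z u) (fderiv ℝ ψ z v)) (u v : E) :
    fderiv ℝ ψ y (christoffel G y u v) = fderiv ℝ (fderiv ℝ ψ) y u v
      + christoffel H (ψ y) (fderiv ℝ ψ y u) (fderiv ℝ ψ y v) := by
  have hd : DifferentiableAt ℝ ψ y := hψ.differentiableAt (by norm_num)
  have hd' : DifferentiableAt ℝ (fderiv ℝ ψ) y :=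
    (hψ.fderiv_right (m := 1) (by norm_num)).differentiableAt (by norm_num)
  have hsymm : IsSymmSndFDerivAt ℝ ψ y := hψ.isSymmSndFDerivAt (by simp)
  -- As `H` is nondegenerate and `dψ` is onto, it suffices to pair both sides with vectors `dψ w`.
  apply hHi.injective
  ext w'
  obtain ⟨w, rfl⟩ := hs w'
  have h0 := fderiv_pullback_metric hG hH hd hd' hGH
  -- Of the six `D²ψ` terms in the Koszul expression, four cancel in pairs; the other two are equal
  -- and absorb the factor `1 / 2`.
  rw [← hGH.self_of_nhds, apply_christoffel hGi, map_add, apply_christoffel hHi,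
    add_apply, christoffelFirst_apply, christoffelFirst_apply, h0, h0, h0,
    hsymm v u, hsymm w u, hsymm w v, hHs (fderiv ℝ ψ y v) (fderiv ℝ (fderiv ℝ ψ) y u w)]
  ring

theorem contDiffAt_christoffelFirst {G : E → E →L[ℝ] E →L[ℝ] ℝ} {y : E}
    (hG : ContDiffAt ℝ 2 G y) : ContDiffAt ℝ 1 (christoffelFirst G) y := by
  have hD : ContDiffAt ℝ 1 (fderiv ℝ G) y := hG.fderiv_right (by norm_num)
  have hf : ContDiffAt ℝ 1 (fun z ↦ (fderiv ℝ G z).flip) y :=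
    (ContinuousLinearMap.flipₗᵢ ℝ E E (E →L[ℝ] ℝ)).toContinuousLinearEquiv.contDiff.contDiffAt.comp
      y hD
  exact ((hD.add hf).sub (contDiffAt_const.clm_comp hf)).const_smul (1 / 2 : ℝ)

theorem differentiableAt_christoffel [CompleteSpace E] {G : E → E →L[ℝ] E →L[ℝ] ℝ} {y : E}
    (hG : ContDiffAt ℝ 2 G y) (hGi : (G y).IsInvertible) :
    DifferentiableAt ℝ (christoffel G) y := by
  obtain ⟨e, he⟩ := hGi
  have hi : ContDiffAt ℝ 1 (fun z ↦ (G z).inverse) y :=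
    (he ▸ contDiffAt_map_inverse e : ContDiffAt ℝ 1 ContinuousLinearMap.inverse (G y)).comp y
      (hG.of_le (by norm_num))
  have hc : ContDiffAt ℝ 1 (fun z ↦ ContinuousLinearMap.compL ℝ E (E →L[ℝ] ℝ) E (G z).inverse) y :=
    (ContinuousLinearMap.contDiff _).contDiffAt.comp y hi
  exact (hc.clm_comp (contDiffAt_christoffelFirst hG)).differentiableAt (by norm_num)

/-- The curvature tensor is natural under local isometries. -/
theorem map_curvature [CompleteSpace E] [CompleteSpace F]
    {G : E → E →L[ℝ] E →L[ℝ] ℝ} {H : F → F →L[ℝ] F →L[ℝ] ℝ}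
    {ψ : E → F} {y : E} (hG : ContDiffAt ℝ 2 G y) (hH : ContDiffAt ℝ 2 H (ψ y))
    (hψ : ContDiffAt ℝ 3 ψ y) (hGi : (G y).IsInvertible) (hHi : (H (ψ y)).IsInvertible)
    (hHs : ∀ z u v, H z u v = H z v u)
    (hΓ : ∀ᶠ z in 𝓝 y, ∀ u v, fderiv ℝ ψ z (christoffel G z u v) = fderiv ℝ (fderiv ℝ ψ) z u v
      + christoffel H (ψ z) (fderiv ℝ ψ z u) (fderiv ℝ ψ z v)) (u v w : E) :
    fderiv ℝ ψ y (curvature G y v w u) =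
      curvature H (ψ y) (fderiv ℝ ψ y v) (fderiv ℝ ψ y w) (fderiv ℝ ψ y u) := by
  have hd : DifferentiableAt ℝ ψ y := hψ.differentiableAt (by norm_num)
  have hd2 : ContDiffAt ℝ 2 (fderiv ℝ ψ) y := hψ.fderiv_right (by norm_num)
  have hd' : DifferentiableAt ℝ (fderiv ℝ ψ) y := hd2.differentiableAt (by norm_num)
  have hd'' : DifferentiableAt ℝ (fderiv ℝ (fderiv ℝ ψ)) y :=
    (hd2.fderiv_right (m := 1) (by norm_num)).differentiableAt (by norm_num)
  have hsymm : IsSymmSndFDerivAt ℝ ψ y :=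
    (hψ.of_le (by norm_num)).isSymmSndFDerivAt (n := 2) (by simp)
  have hsymm3 : IsSymmSndFDerivAt ℝ (fderiv ℝ ψ) y := hd2.isSymmSndFDerivAt (by simp)
  have hΓG := differentiableAt_christoffel hG hGi
  have hΓH := differentiableAt_christoffel hH hHi
  have hΓs := christoffel_symm (hH.differentiableAt (by norm_num)) hHs
  -- The derivative of the transformation rule `hΓ` in the direction `a`.
  have key (a b c : E) :
      fderiv ℝ (fderiv ℝ ψ) y a (christoffel G y b c)
          + fderiv ℝ ψ y (fderiv ℝ (christoffel G) y a b c) =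
        fderiv ℝ (fderiv ℝ (fderiv ℝ ψ)) y a b c
          + (fderiv ℝ (christoffel H) (ψ y) (fderiv ℝ ψ y a) (fderiv ℝ ψ y b) (fderiv ℝ ψ y c)
            + christoffel H (ψ y) (fderiv ℝ (fderiv ℝ ψ) y a b) (fderiv ℝ ψ y c)
            + christoffel H (ψ y) (fderiv ℝ ψ y b) (fderiv ℝ (fderiv ℝ ψ) y a c)) := by
    have hD (u : E) := hd'.hasFDerivAt.clm_apply (hasFDerivAt_const u y)
    have h1 := hd'.hasFDerivAt.clm_apply
      ((hΓG.hasFDerivAt.clm_apply (hasFDerivAt_const b y)).clm_apply (hasFDerivAt_const c y))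
    have h2 := ((hd''.hasFDerivAt.clm_apply (hasFDerivAt_const b y)).clm_apply
      (hasFDerivAt_const c y)).add
      (((hΓH.hasFDerivAt.comp y hd.hasFDerivAt).clm_apply (hD b)).clm_apply (hD c))
    have h3 := h1.unique (h2.congr_of_eventuallyEq (hΓ.mono fun z hz ↦ hz b c))
    have h4 := congrArg (fun L : E →L[ℝ] F ↦ L a) h3
    simp at h4
    rw [add_comm, h4]
    abel
  have k1 := eq_sub_of_add_eq' (key u v w)
  have k2 := eq_sub_of_add_eq' (key v u w)
  have hΓy := hΓ.self_of_nhds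
  simp only [curvature_apply, map_add, map_sub, k1, k2, hΓy]
  -- Symmetry in `u, v` kills `D³ψ(u, v, w)` and `Γ_H(D²ψ(u, v), dψ w)`; the remaining `D²ψ` terms
  -- cancel against those from the quadratic part of the curvature.
  rw [hsymm3 v u, hsymm v u]
  abel

/-- By `hR`, the linear isomorphism `L` conjugates one curvature endomorphism into the other, and
the trace is invariant under conjugation. -/
theorem map_ricci [FiniteDimensional ℝ E] [FiniteDimensional ℝ F]
    {G : E → E →L[ℝ] E →L[ℝ] ℝ} {H : F → F →L[ℝ] F →L[ℝ] ℝ} {y : E} {y' : F} {L : E →L[ℝ] F}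
    (hL : Function.Bijective L)
    (hR : ∀ u v w, L (curvature G y v w u) = curvature H y' (L v) (L w) (L u)) (v w : E) :
    ricci H y' (L v) (L w) = ricci G y v w := by
  rw [ricci_apply, ricci_apply,
    ← LinearMap.trace_conj' _ (LinearEquiv.ofBijective (L : E →ₗ[ℝ] F) hL)]
  congr 1
  ext x
  obtain ⟨u, rfl⟩ := hL.2 x
  have : (LinearEquiv.ofBijective (L : E →ₗ[ℝ] F) hL).symm (L u) = u :=
    (LinearEquiv.ofBijective (L : E →ₗ[ℝ] F) hL).symm_apply_apply u
  simp [LinearEquiv.conj_apply, this, hR]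

/-- The second derivative of a curve under a change of coordinates. -/
theorem derivWithin_derivWithin_comp {S : Set ℝ} (hS : UniqueDiffOn ℝ S) {ψ : E → F} {c : ℝ → E}
    {t : ℝ} (ht : t ∈ S) (hψ : ContDiffAt ℝ 2 ψ (c t)) (hc : ContDiffWithinAt ℝ 2 c S t) :
    derivWithin (ψ ∘ c) S t = fderiv ℝ ψ (c t) (derivWithin c S t) ∧
    derivWithin (derivWithin (ψ ∘ c) S) S t =
      fderiv ℝ (fderiv ℝ ψ) (c t) (derivWithin c S t) (derivWithin c S t)
        + fderiv ℝ ψ (c t) (derivWithin (derivWithin c S) S t) := by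
  -- The first-order chain rule is needed at all nearby times in `S`, because it is differentiated
  -- again.
  have hev : ∀ᶠ s in 𝓝[S] t, derivWithin (ψ ∘ c) S s = fderiv ℝ ψ (c s) (derivWithin c S s) := by
    have h1 : ∀ᶠ s in 𝓝[S] t, ContDiffAt ℝ 2 ψ (c s) :=
      hc.continuousWithinAt.eventually (hψ.eventually (by simp))
    have h2 : ∀ᶠ s in 𝓝[S] t, ContDiffWithinAt ℝ 2 c S s := by
      have := hc.eventually (by simp)
      rwa [Set.insert_eq_of_mem ht] at this
    filter_upwards [h1, h2, self_mem_nhdsWithin] with s hs1 hs2 hs3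
    exact ((hs1.differentiableAt (by norm_num)).hasFDerivAt.comp_hasDerivWithinAt s
      (hs2.differentiableWithinAt (by norm_num)).hasDerivWithinAt).derivWithin (hS s hs3)
  refine ⟨hev.self_of_nhdsWithin ht, ?_⟩
  have hd' : DifferentiableAt ℝ (fderiv ℝ ψ) (c t) :=
    (hψ.fderiv_right (m := 1) (by norm_num)).differentiableAt (by norm_num)
  have hc' : DifferentiableWithinAt ℝ (derivWithin c S) S t :=
    (hc.derivWithin hS (m := 1) (by norm_num) ht).differentiableWithinAt (by norm_num)
  rw [EventuallyEq.derivWithin_eq hev (hev.self_of_nhdsWithin ht)]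
  have := (hd'.hasFDerivAt.comp_hasDerivWithinAt t
    (hc.differentiableWithinAt (by norm_num)).hasDerivWithinAt).clm_apply hc'.hasDerivWithinAt
  exact this.derivWithin (hS t ht)

end Local

/-! ### Maps and metrics read in charts. -/

section Kahler

variable {E : Type*} [NormedAddCommGroup E] [NormedSpace ℂ E]
  {M : Type*} [TopologicalSpace M] [ChartedSpace E M]
  {F : Type*} [NormedAddCommGroup F] [NormedSpace ℂ F]
  {N : Type*} [TopologicalSpace N] [ChartedSpace F N] {f : M → N}

theorem mfderiv_eq_fderiv_writtenInExtChartAt {x : M}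
    (hf : MDifferentiableAt 𝓘(ℝ, E) 𝓘(ℝ, F) f x) :
    (mfderiv 𝓘(ℝ, E) 𝓘(ℝ, F) f x : E →L[ℝ] F) =
      fderiv ℝ (writtenInExtChartAt 𝓘(ℝ, E) 𝓘(ℝ, F) x f) (extChartAt 𝓘(ℝ, E) x x) := by
  have h := hf.mfderiv
  rw [modelWithCornersSelf_coe, Set.range_id, fderivWithin_univ] at h
  exact h

/-- Cauchy–Riemann: the real derivative of the chart representation is the restriction of a
complex-linear map, so it commutes with `i`. -/
theorem mfderiv_complexStructure {x : M} (hol : MDifferentiableAt 𝓘(ℂ, E) 𝓘(ℂ, F) f x)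
    (hf : MDifferentiableAt 𝓘(ℝ, E) 𝓘(ℝ, F) f x) (v : TangentSpace 𝓘(ℝ, E) x) :
    mfderiv 𝓘(ℝ, E) 𝓘(ℝ, F) f x (complexStructure x v) =
      complexStructure (f x) (mfderiv 𝓘(ℝ, E) 𝓘(ℝ, F) f x v) := by
  have hd : DifferentiableAt ℂ (writtenInExtChartAt 𝓘(ℝ, E) 𝓘(ℝ, F) x f)
      (extChartAt 𝓘(ℝ, E) x x) := by
    have := hol.differentiableWithinAt_writtenInExtChartAt
    rw [modelWithCornersSelf_coe, Set.range_id, differentiableWithinAt_univ] at this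
    exact this
  have key (L : E →L[ℝ] F) (L' : E →L[ℂ] F) (hL : L = L'.restrictScalars ℝ) (w : E) :
      L (Complex.I • w) = Complex.I • L w := by
    subst hL
    simp
  exact key _ _ ((mfderiv_eq_fderiv_writtenInExtChartAt hf).trans (hd.fderiv_restrictScalars ℝ)) v

variable [IsManifold 𝓘(ℂ, E) ω M] [IsManifold 𝓘(ℂ, F) ω N]
  {g : KahlerMetric E M} {h : KahlerMetric F N}

/-- The tangent space at `x` is identified with `E` through this very chart. -/
theorem chartDifferential_eq_id (x : M) :
    chartDifferential (E := E) x = ContinuousLinearMap.id ℝ E :=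
  mfderiv_extChartAt_self

theorem isInvertible_inverseChartDifferential {p : M} {y : E}
    (hy : y ∈ (extChartAt 𝓘(ℝ, E) p).target) :
    (inverseChartDifferential p y).IsInvertible := by
  have h := isInvertible_mfderivWithin_extChartAt_symm (I := 𝓘(ℝ, E)) hy
  rw [modelWithCornersSelf_coe, Set.range_id, mfderivWithin_univ] at h
  exact h

theorem KahlerMetric.chartPullback_symm (g : KahlerMetric E M) (p : M) (y u v : E) :
    chartPullback g.inner p y u v = chartPullback g.inner p y v u := by
  rw [chartPullback_apply, chartPullback_apply, g.symm]

/-- Positivity makes `B` injective into the dual, which has the same finite dimension. -/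
theorem isInvertible_of_posDef [FiniteDimensional ℝ E] {B : E →L[ℝ] E →L[ℝ] ℝ}
    (hB : ∀ v, v ≠ 0 → 0 < B v v) : B.IsInvertible := by
  have hinj : Function.Injective (B : E →ₗ[ℝ] E →L[ℝ] ℝ) := by
    rw [injective_iff_map_eq_zero]
    intro v hv
    by_contra hne
    have h := hB v hne
    have h0 : B v = 0 := hv
    simp [h0] at h
  have hfin : Module.finrank ℝ E = Module.finrank ℝ (E →L[ℝ] ℝ) :=
    (Subspace.dual_finrank_eq (K := ℝ) (V := E)).symm.trans
      (LinearMap.toContinuousLinearMap (𝕜 := ℝ) (E := E) (F' := ℝ)).finrank_eq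
  exact ⟨(LinearEquiv.ofInjectiveOfFinrankEq _ hinj hfin).toContinuousLinearEquiv, rfl⟩

theorem KahlerMetric.isInvertible_inner [FiniteDimensional ℝ E] (g : KahlerMetric E M) (x : M) :
    (g.inner x : E →L[ℝ] E →L[ℝ] ℝ).IsInvertible :=
  isInvertible_of_posDef (E := E) (B := g.inner x) (g.pos x)

theorem KahlerMetric.isInvertible_chartPullback [FiniteDimensional ℝ E] (g : KahlerMetric E M)
    {p : M} {y : E} (hy : y ∈ (extChartAt 𝓘(ℝ, E) p).target) :
    (chartPullback g.inner p y).IsInvertible := by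
  refine isInvertible_of_posDef fun v hv ↦ ?_
  have hne : inverseChartDifferential p y v ≠ 0 := fun h0 ↦ hv <|
    (isInvertible_inverseChartDifferential hy).injective
      (h0.trans (map_zero (inverseChartDifferential p y)).symm)
  exact g.pos ((extChartAt 𝓘(ℝ, E) p).symm y) (inverseChartDifferential p y v) hne

/-- This is the tangent map of the inverse chart applied to the constant field `u`. -/
theorem contMDiffOn_inverseChartDifferential (p : M) (u : E) :
    ContMDiffOn 𝓘(ℝ, E) 𝓘(ℝ, E).tangent ∞
      (fun y ↦ (⟨(extChartAt 𝓘(ℝ, E) p).symm y,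
        mfderiv 𝓘(ℝ, E) 𝓘(ℝ, E) (extChartAt 𝓘(ℝ, E) p).symm y u⟩ : TangentBundle 𝓘(ℝ, E) M))
      (extChartAt 𝓘(ℝ, E) p).target := by
  have ho : IsOpen (extChartAt 𝓘(ℝ, E) p).target := isOpen_extChartAt_target p
  have h1 := (contMDiffOn_extChartAt_symm (I := 𝓘(ℝ, E)) (n := ω) p).contMDiffOn_tangentMapWithin
    (m := ∞) le_top ho.uniqueMDiffOn
  have h2 : ContMDiffOn 𝓘(ℝ, E) 𝓘(ℝ, E).tangent ∞
      (fun y : E ↦ (⟨y, u⟩ : TangentBundle 𝓘(ℝ, E) E)) (extChartAt 𝓘(ℝ, E) p).target :=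
    contMDiffOn_vectorSpace_iff_contDiffOn.2 contDiffOn_const
  refine (h1.comp h2 fun y hy ↦ hy).congr fun y hy ↦ ?_
  simp only [Function.comp_apply, tangentMapWithin]
  rw [mfderivWithin_of_isOpen ho hy]

theorem KahlerMetric.contDiffOn_chartPullback [FiniteDimensional ℝ E] (g : KahlerMetric E M)
    (p : M) : ContDiffOn ℝ ∞ (chartPullback g.inner p) (extChartAt 𝓘(ℝ, E) p).target := by
  refine contDiffOn_clm_apply.2 fun u ↦ contDiffOn_clm_apply.2 fun v ↦ ContMDiffOn.contDiffOn ?_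
  have hv (u : E) := contMDiffOn_inverseChartDifferential p u
  intro y hy
  have : ContMDiffWithinAt 𝓘(ℝ, E) (𝓘(ℝ, E).prod 𝓘(ℝ)) ∞
      (fun y ↦ TotalSpace.mk' ℝ (E := Bundle.Trivial M ℝ) ((extChartAt 𝓘(ℝ, E) p).symm y)
        (g.inner ((extChartAt 𝓘(ℝ, E) p).symm y)
          (mfderiv 𝓘(ℝ, E) 𝓘(ℝ, E) (extChartAt 𝓘(ℝ, E) p).symm y u)
          (mfderiv 𝓘(ℝ, E) 𝓘(ℝ, E) (extChartAt 𝓘(ℝ, E) p).symm y v)))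
      (extChartAt 𝓘(ℝ, E) p).target y := by
    apply ContMDiffWithinAt.clm_bundle_apply₂ (F₁ := E) (F₂ := E)
    · exact ContMDiffAt.comp_contMDiffWithinAt y g.contMDiff.contMDiffAt
        (contMDiffOn_extChartAt_symm p y hy)
    · exact hv u y hy
    · exact hv v y hy
  simp only [contMDiffWithinAt_totalSpace] at this
  exact this.2

theorem contDiffAt_writtenInExtChartAt (hf : ContMDiff 𝓘(ℝ, E) 𝓘(ℝ, F) ∞ f) {x : M} {y : E}
    (hy : y ∈ (extChartAt 𝓘(ℝ, E) x).target)
    (hy' : f ((extChartAt 𝓘(ℝ, E) x).symm y) ∈ (extChartAt 𝓘(ℝ, F) (f x)).source) :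
    ContDiffAt ℝ ∞ (writtenInExtChartAt 𝓘(ℝ, E) 𝓘(ℝ, F) x f) y := by
  have h1 : ContMDiffAt 𝓘(ℝ, E) 𝓘(ℝ, E) ∞ (extChartAt 𝓘(ℝ, E) x).symm y :=
    (contMDiffOn_extChartAt_symm x).contMDiffAt ((isOpen_extChartAt_target x).mem_nhds hy)
  have h2 : ContMDiffAt 𝓘(ℝ, F) 𝓘(ℝ, F) ∞ (extChartAt 𝓘(ℝ, F) (f x))
      (f ((extChartAt 𝓘(ℝ, E) x).symm y)) :=
    contMDiffAt_extChartAt' (by rwa [extChartAt_source] at hy')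
  exact (h2.comp y (hf.contMDiffAt.comp y h1)).contDiffAt

/-- Near `y`, `ψ` followed by the inverse chart of `N` equals the inverse chart of `M` followed by
`f`; differentiate this and apply the isometry. -/
theorem IsLocalIsometry.chartPullback_eq (iso : IsLocalIsometry g h f) {x : M} {y : E}
    (hy : y ∈ (extChartAt 𝓘(ℝ, E) x).target)
    (hy' : f ((extChartAt 𝓘(ℝ, E) x).symm y) ∈ (extChartAt 𝓘(ℝ, F) (f x)).source) (u v : E) :
    chartPullback g.inner x y u v =
      chartPullback h.inner (f x) (writtenInExtChartAt 𝓘(ℝ, E) 𝓘(ℝ, F) x f y)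
        (fderiv ℝ (writtenInExtChartAt 𝓘(ℝ, E) 𝓘(ℝ, F) x f) y u)
        (fderiv ℝ (writtenInExtChartAt 𝓘(ℝ, E) 𝓘(ℝ, F) x f) y v) := by
  set ψ := writtenInExtChartAt 𝓘(ℝ, E) 𝓘(ℝ, F) x f with hψ
  have h1 : ContMDiffAt 𝓘(ℝ, E) 𝓘(ℝ, E) ∞ (extChartAt 𝓘(ℝ, E) x).symm y :=
    (contMDiffOn_extChartAt_symm x).contMDiffAt ((isOpen_extChartAt_target x).mem_nhds hy)
  have hψy : ψ y ∈ (extChartAt 𝓘(ℝ, F) (f x)).target := (extChartAt 𝓘(ℝ, F) (f x)).map_source hy'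
  have h3 : ContMDiffAt 𝓘(ℝ, F) 𝓘(ℝ, F) ∞ (extChartAt 𝓘(ℝ, F) (f x)).symm (ψ y) :=
    (contMDiffOn_extChartAt_symm (f x)).contMDiffAt ((isOpen_extChartAt_target _).mem_nhds hψy)
  have hd2 := (iso.smooth.contMDiffAt.mdifferentiableAt (by simp)).hasMFDerivAt.comp y
    (h1.mdifferentiableAt (by simp)).hasMFDerivAt
  have hd1 := (h3.mdifferentiableAt (by simp)).hasMFDerivAt.comp y
    ((contDiffAt_writtenInExtChartAt iso.smooth hy hy').differentiableAt
      (by simp)).hasFDerivAt.hasMFDerivAt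
  have heq : (extChartAt 𝓘(ℝ, F) (f x)).symm ∘ ψ =ᶠ[𝓝 y] f ∘ (extChartAt 𝓘(ℝ, E) x).symm := by
    have hc : ContinuousAt (f ∘ (extChartAt 𝓘(ℝ, E) x).symm) y := hd2.continuousAt
    filter_upwards [hc.preimage_mem_nhds ((isOpen_extChartAt_source (f x)).mem_nhds hy')] with z hz
    exact (extChartAt 𝓘(ℝ, F) (f x)).left_inv hz
  have hD := hasMFDerivAt_unique (hd1.congr_of_eventuallyEq heq.symm) hd2
  have hpt : (extChartAt 𝓘(ℝ, F) (f x)).symm (ψ y) = f ((extChartAt 𝓘(ℝ, E) x).symm y) :=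
    heq.self_of_nhds
  have hDu (u : E) : inverseChartDifferential (f x) (ψ y) (fderiv ℝ ψ y u) =
      mfderiv 𝓘(ℝ, E) 𝓘(ℝ, F) f ((extChartAt 𝓘(ℝ, E) x).symm y) (inverseChartDifferential x y u) :=
    congrArg (fun L : E →L[ℝ] F ↦ L u) hD
  -- The base points agree only propositionally, so the fibres are viewed as copies of `F` to allow
  -- substitution.
  have hcongr (a b : N) (hab : a = b) (v w v' w' : F) (hv : v = v') (hw : w = w') :
      (h.inner a : F →L[ℝ] F →L[ℝ] ℝ) v w = (h.inner b : F →L[ℝ] F →L[ℝ] ℝ) v' w' := by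
    subst hab hv hw
    rfl
  exact ((hcongr _ _ hpt _ _ _ _ (hDu u) (hDu v)).trans (iso.isometric _ _ _)).symm

end Kahler

/-! ### Naturality of the Ricci form, the metric isomorphism and the acceleration. -/

section Kahler

theorem two_le_infty : (2 : WithTop ℕ∞) ≤ ∞ :=
  WithTop.coe_le_coe.2 (le_top : (2 : ℕ∞) ≤ ⊤)

theorem three_le_infty : (3 : WithTop ℕ∞) ≤ ∞ :=
  WithTop.coe_le_coe.2 (le_top : (3 : ℕ∞) ≤ ⊤)

variable {E : Type*} [NormedAddCommGroup E] [NormedSpace ℂ E]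
  {M : Type*} [TopologicalSpace M] [ChartedSpace E M]
  {F : Type*} [NormedAddCommGroup F] [NormedSpace ℂ F]
  {N : Type*} [TopologicalSpace N] [ChartedSpace F N] {f : M → N}

theorem velocity_comp {S : Set ℝ} (hS : UniqueDiffOn ℝ S)
    (hf : MDifferentiable 𝓘(ℝ, E) 𝓘(ℝ, F) f) {α : ℝ → M} {t : ℝ} (ht : t ∈ S)
    (hα : MDifferentiableWithinAt 𝓘(ℝ, ℝ) 𝓘(ℝ, E) α S t) :
    velocity (E := F) S (f ∘ α) t =
      mfderiv 𝓘(ℝ, E) 𝓘(ℝ, F) f (α t) (velocity (E := E) S α t) := by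
  have h := ((hf (α t)).hasMFDerivAt.comp_hasMFDerivWithinAt t hα.hasMFDerivWithinAt).mfderivWithin
    (hS.uniqueMDiffOn t ht)
  simp only [velocity]
  rw [h]
  rfl

theorem eventually_mem_chart_domain (hf : Continuous f) (x : M) :
    ∀ᶠ y in 𝓝 (extChartAt 𝓘(ℝ, E) x x), y ∈ (extChartAt 𝓘(ℝ, E) x).target ∧
      f ((extChartAt 𝓘(ℝ, E) x).symm y) ∈ (extChartAt 𝓘(ℝ, F) (f x)).source := by
  have hc : ContinuousAt (f ∘ (extChartAt 𝓘(ℝ, E) x).symm) (extChartAt 𝓘(ℝ, E) x x) :=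
    hf.continuousAt.comp (continuousAt_extChartAt_symm x)
  refine ((isOpen_extChartAt_target x).eventually_mem (mem_extChartAt_target x)).and
    (hc.eventually_mem ?_)
  simpa using extChartAt_source_mem_nhds (I := 𝓘(ℝ, F)) (f x)

variable [IsManifold 𝓘(ℂ, E) ω M] [IsManifold 𝓘(ℂ, F) ω N]
  {g : KahlerMetric E M} {h : KahlerMetric F N}

theorem IsLocalIsometry.bijective_fderiv (iso : IsLocalIsometry g h f) (x : M) :
    Function.Bijective (fderiv ℝ (writtenInExtChartAt 𝓘(ℝ, E) 𝓘(ℝ, F) x f)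
      (extChartAt 𝓘(ℝ, E) x x)) := by
  rw [← mfderiv_eq_fderiv_writtenInExtChartAt (iso.smooth.contMDiffAt.mdifferentiableAt (by simp))]
  exact iso.bijective x

variable [FiniteDimensional ℝ E] [FiniteDimensional ℝ F]

theorem IsLocalIsometry.map_christoffel (iso : IsLocalIsometry g h f) {x : M} {y : E}
    (hy : y ∈ (extChartAt 𝓘(ℝ, E) x).target)
    (hy' : f ((extChartAt 𝓘(ℝ, E) x).symm y) ∈ (extChartAt 𝓘(ℝ, F) (f x)).source)
    (hs : Function.Surjective (fderiv ℝ (writtenInExtChartAt 𝓘(ℝ, E) 𝓘(ℝ, F) x f) y))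
    (hev : ∀ᶠ y in 𝓝 y, y ∈ (extChartAt 𝓘(ℝ, E) x).target ∧
      f ((extChartAt 𝓘(ℝ, E) x).symm y) ∈ (extChartAt 𝓘(ℝ, F) (f x)).source) (u v : E) :
    let ψ := writtenInExtChartAt 𝓘(ℝ, E) 𝓘(ℝ, F) x f
    fderiv ℝ ψ y (christoffel (chartPullback g.inner x) y u v) = fderiv ℝ (fderiv ℝ ψ) y u v
      + christoffel (chartPullback h.inner (f x)) (ψ y) (fderiv ℝ ψ y u) (fderiv ℝ ψ y v) := by
  have hψy := (extChartAt 𝓘(ℝ, F) (f x)).map_source hy'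
  exact RMG.map_christoffel
    (((g.contDiffOn_chartPullback x).contDiffAt
      ((isOpen_extChartAt_target x).mem_nhds hy)).differentiableAt (by simp))
    (((h.contDiffOn_chartPullback (f x)).contDiffAt
      ((isOpen_extChartAt_target _).mem_nhds hψy)).differentiableAt (by simp))
    ((contDiffAt_writtenInExtChartAt iso.smooth hy hy').of_le two_le_infty)
    (g.isInvertible_chartPullback hy) (h.isInvertible_chartPullback hψy)
    (h.chartPullback_symm _ _) hs
    (hev.mono fun z hz ↦ iso.chartPullback_eq hz.1 hz.2) u v

/-- The transformation rule of the Christoffel symbols holds near the centre of the chart. -/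
theorem IsLocalIsometry.eventually_map_christoffel (iso : IsLocalIsometry g h f) (x : M) :
    let ψ := writtenInExtChartAt 𝓘(ℝ, E) 𝓘(ℝ, F) x f
    ∀ᶠ y in 𝓝 (extChartAt 𝓘(ℝ, E) x x), ∀ u v,
      fderiv ℝ ψ y (christoffel (chartPullback g.inner x) y u v) = fderiv ℝ (fderiv ℝ ψ) y u v
        + christoffel (chartPullback h.inner (f x)) (ψ y) (fderiv ℝ ψ y u) (fderiv ℝ ψ y v) := by
  intro ψ
  have hev := eventually_mem_chart_domain (E := E) (F := F) iso.smooth.continuous x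
  have h0 := hev.self_of_nhds
  obtain ⟨e, he⟩ : (fderiv ℝ ψ (extChartAt 𝓘(ℝ, E) x x)).IsInvertible :=
    ⟨(LinearEquiv.ofBijective _ (iso.bijective_fderiv x)).toContinuousLinearEquiv, rfl⟩
  have hcont : ContinuousAt (fderiv ℝ ψ) (extChartAt 𝓘(ℝ, E) x x) :=
    ((contDiffAt_writtenInExtChartAt iso.smooth h0.1 h0.2).fderiv_right
      (m := 0) (by simp)).continuousAt
  -- Invertible operators form an open set, so `dψ` stays invertible near the centre.
  have hinv := hcont.preimage_mem_nhds (he ▸ e.nhds)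
  filter_upwards [hev, hev.eventually_nhds, hinv] with y hy hy' ⟨e', he'⟩
  exact iso.map_christoffel hy.1 hy.2 (he' ▸ e'.surjective) hy'

theorem KahlerMetric.ricciTensor_eq (g : KahlerMetric E M) (x : M) :
    g.ricciTensor x = ricci (chartPullback g.inner x) (extChartAt 𝓘(ℝ, E) x x) := by
  have key (B : E →L[ℝ] E →L[ℝ] ℝ) (L : E →L[ℝ] E) (hL : L = ContinuousLinearMap.id ℝ E) :
      B.bilinearComp L L = B := by
    subst hL
    rfl
  exact key _ _ (chartDifferential_eq_id x)

theorem IsLocalIsometry.ricciTensor_map (iso : IsLocalIsometry g h f) (x : M)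
    (v w : TangentSpace 𝓘(ℝ, E) x) :
    h.ricciTensor (f x) (mfderiv 𝓘(ℝ, E) 𝓘(ℝ, F) f x v) (mfderiv 𝓘(ℝ, E) 𝓘(ℝ, F) f x w) =
      g.ricciTensor x v w := by
  have hd := iso.smooth.contMDiffAt.mdifferentiableAt (x := x) (by simp)
  have h0 := (eventually_mem_chart_domain (E := E) (F := F) iso.smooth.continuous x).self_of_nhds
  have hψ0 := (extChartAt 𝓘(ℝ, F) (f x)).map_source h0.2
  have hval : writtenInExtChartAt 𝓘(ℝ, E) 𝓘(ℝ, F) x f (extChartAt 𝓘(ℝ, E) x x) =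
      extChartAt 𝓘(ℝ, F) (f x) (f x) := by
    simp [writtenInExtChartAt]
  have key := map_ricci (iso.bijective_fderiv x) fun u v w ↦ map_curvature
    (((g.contDiffOn_chartPullback x).contDiffAt
      ((isOpen_extChartAt_target x).mem_nhds h0.1)).of_le two_le_infty)
    (((h.contDiffOn_chartPullback (f x)).contDiffAt
      ((isOpen_extChartAt_target _).mem_nhds hψ0)).of_le two_le_infty)
    ((contDiffAt_writtenInExtChartAt iso.smooth h0.1 h0.2).of_le three_le_infty)
    (g.isInvertible_chartPullback h0.1) (h.isInvertible_chartPullback hψ0)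
    (h.chartPullback_symm _) (iso.eventually_map_christoffel x) u v w
  rw [← mfderiv_eq_fderiv_writtenInExtChartAt hd, hval] at key
  rw [g.ricciTensor_eq, h.ricciTensor_eq]
  exact key v w

/-- Holomorphy enters the argument here, to move `J` across `df`. -/
theorem IsLocalIsometry.ricciForm_map (iso : IsLocalIsometry g h f)
    (hol : MDifferentiable 𝓘(ℂ, E) 𝓘(ℂ, F) f) (x : M) (v w : TangentSpace 𝓘(ℝ, E) x) :
    h.ricciForm (f x) (mfderiv 𝓘(ℝ, E) 𝓘(ℝ, F) f x v) (mfderiv 𝓘(ℝ, E) 𝓘(ℝ, F) f x w) =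
      g.ricciForm x v w := by
  change h.ricciTensor (f x) (complexStructure (f x) (mfderiv 𝓘(ℝ, E) 𝓘(ℝ, F) f x v)) _ =
    g.ricciTensor x (complexStructure x v) w
  rw [← mfderiv_complexStructure (hol x) (iso.smooth.contMDiffAt.mdifferentiableAt (by simp))]
  exact iso.ricciTensor_map x _ _

theorem KahlerMetric.inner_sharp (g : KahlerMetric E M) (x : M)
    (θ : TangentSpace 𝓘(ℝ, E) x →L[ℝ] ℝ) : g.inner x (g.sharp x θ) = θ :=
  (g.isInvertible_inner x).self_apply_inverse θ

/-- When `θ` is the pullback of `θ'`, both sides have the same inner product with every `df w`, and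
these fill the target tangent space. -/
theorem IsLocalIsometry.map_sharp (iso : IsLocalIsometry g h f) (x : M)
    (θ : TangentSpace 𝓘(ℝ, E) x →L[ℝ] ℝ) (θ' : TangentSpace 𝓘(ℝ, F) (f x) →L[ℝ] ℝ)
    (hθ : ∀ w, θ' (mfderiv 𝓘(ℝ, E) 𝓘(ℝ, F) f x w) = θ w) :
    mfderiv 𝓘(ℝ, E) 𝓘(ℝ, F) f x (g.sharp x θ) = h.sharp (f x) θ' := by
  refine (h.isInvertible_inner (f x)).injective (ContinuousLinearMap.ext fun w' ↦ ?_)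
  obtain ⟨w, rfl⟩ := (iso.bijective x).2 w'
  refine (iso.isometric x _ _).trans ?_
  rw [g.inner_sharp, ← hθ w]
  exact (congrArg (fun L : TangentSpace 𝓘(ℝ, F) (f x) →L[ℝ] ℝ ↦
    L (mfderiv 𝓘(ℝ, E) 𝓘(ℝ, F) f x w)) (h.inner_sharp (f x) θ')).symm

/-- The term `D²ψ(c', c')` of `(ψ ∘ c)''` is exactly the inhomogeneous term in the rule for the
Christoffel symbols. -/
theorem IsLocalIsometry.map_covariantAcceleration (iso : IsLocalIsometry g h f) {S : Set ℝ}
    (hS : UniqueDiffOn ℝ S) {α : ℝ → M} (hα : ContMDiffOn 𝓘(ℝ, ℝ) 𝓘(ℝ, E) ∞ α S) {t : ℝ}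
    (ht : t ∈ S) :
    mfderiv 𝓘(ℝ, E) 𝓘(ℝ, F) f (α t) (g.covariantAcceleration S α t) =
      h.covariantAcceleration S (f ∘ α) t := by
  have hd := iso.smooth.contMDiffAt.mdifferentiableAt (x := α t) (by simp)
  have h0 := (eventually_mem_chart_domain (E := E) (F := F)
    iso.smooth.continuous (α t)).self_of_nhds
  set c : ℝ → E := fun s ↦ extChartAt 𝓘(ℝ, E) (α t) (α s) with hc
  set d : ℝ → F := fun s ↦ extChartAt 𝓘(ℝ, F) (f (α t)) (f (α s)) with hdd
  set ψ := writtenInExtChartAt 𝓘(ℝ, E) 𝓘(ℝ, F) (α t) f with hψ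
  have hcs : ContDiffWithinAt ℝ 2 c S t :=
    ((contMDiffAt_extChartAt (I := 𝓘(ℝ, E)) (n := ∞)).comp_contMDiffWithinAt t
      (hα t ht)).contDiffWithinAt.of_le two_le_infty
  have hψs : ContDiffAt ℝ 2 ψ (c t) :=
    (contDiffAt_writtenInExtChartAt iso.smooth h0.1 h0.2).of_le two_le_infty
  -- The identity holds only while `α` stays in the chart at `α t`; agreement near `t` within `S`
  -- suffices for both derivatives.
  have hev : d =ᶠ[𝓝[S] t] ψ ∘ c := by
    filter_upwards [(hα t ht).continuousWithinAt.eventually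
      (extChartAt_source_mem_nhds (I := 𝓘(ℝ, E)) (α t))] with s hs
    simp only [hψ, hc, hdd, writtenInExtChartAt, Function.comp_apply]
    rw [(extChartAt 𝓘(ℝ, E) (α t)).left_inv hs]
  have hev' : derivWithin d S =ᶠ[𝓝[S] t] derivWithin (ψ ∘ c) S :=
    (hev.fderivWithin (𝕜 := ℝ)).mono fun s hs ↦ congrArg (fun L : ℝ →L[ℝ] F ↦ L 1) hs
  obtain ⟨h1, h2⟩ := derivWithin_derivWithin_comp hS ht hψs hcs
  have hd1 := (hev'.self_of_nhdsWithin ht).trans h1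
  have hd2 := (hev'.derivWithin_eq (hev'.self_of_nhdsWithin ht)).trans h2
  have hΓ := (iso.eventually_map_christoffel (α t)).self_of_nhds
  have hM : g.covariantAcceleration S α t = derivWithin (derivWithin c S) S t
      + christoffel (chartPullback g.inner (α t)) (c t) (derivWithin c S t)
        (derivWithin c S t) := by
    simp only [KahlerMetric.covariantAcceleration, chartDifferential_eq_id,
      ContinuousLinearMap.inverse_id]
    rfl
  have hN : h.covariantAcceleration S (f ∘ α) t = derivWithin (derivWithin d S) S t
      + christoffel (chartPullback h.inner (f (α t))) (d t) (derivWithin d S t)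
        (derivWithin d S t) := by
    simp only [KahlerMetric.covariantAcceleration, chartDifferential_eq_id,
      ContinuousLinearMap.inverse_id]
    rfl
  refine Eq.trans ?_ hN.symm
  rw [hM, hd1, hd2, hev.self_of_nhdsWithin ht]
  refine (congrArg (fun L : E →L[ℝ] F ↦ L _) (mfderiv_eq_fderiv_writtenInExtChartAt hd)).trans ?_
  refine (map_add (fderiv ℝ ψ (c t)) _ _).trans ?_
  rw [hΓ]
  simp only [Function.comp_apply]
  abel

theorem IsRMG.comp {l : ℝ} {S : Set ℝ} {α : ℝ → M} (hα : IsRMG g l S α) (hS : UniqueDiffOn ℝ S)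
    (iso : IsLocalIsometry g h f) (hol : MDifferentiable 𝓘(ℂ, E) 𝓘(ℂ, F) f) :
    IsRMG h l S (f ∘ α) where
  smooth := iso.smooth.comp_contMDiffOn hα.smooth
  equation t ht := by
    rw [← iso.map_covariantAcceleration hS hα.smooth ht, hα.equation t ht,
      velocity_comp hS (iso.smooth.mdifferentiable (by simp)) ht
        ((hα.smooth t ht).mdifferentiableWithinAt (by simp))]
    refine (map_smul (mfderiv 𝓘(ℝ, E) 𝓘(ℝ, F) f (α t)) l _).trans ?_
    rw [iso.map_sharp (α t) _ _ fun w ↦ iso.ricciForm_map hol (α t) _ w]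
    rfl

end Kahler
end RMG

theorem proposition2p1
    {E : Type*} [NormedAddCommGroup E] [NormedSpace ℂ E] [FiniteDimensional ℂ E]
    {F : Type*} [NormedAddCommGroup F] [NormedSpace ℂ F] [FiniteDimensional ℂ F]
    {M : Type*} [TopologicalSpace M] [ChartedSpace E M] [IsManifold 𝓘(ℂ, E) ω M]
    {N : Type*} [TopologicalSpace N] [ChartedSpace F N] [IsManifold 𝓘(ℂ, F) ω N]
    (gM : RMG.KahlerMetric E M) (gN : RMG.KahlerMetric F N)
    (φ : M → N) (hol : MDifferentiable 𝓘(ℂ, E) 𝓘(ℂ, F) φ) (iso : RMG.IsLocalIsometry gM gN φ)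
    (S : Set ℝ) (hS : S.OrdConnected) (hS' : S.Nontrivial)
    (l : ℝ) (α : ℝ → M) (hα : RMG.IsRMG gM l S α) :
    RMG.IsRMG gN l S (φ ∘ α) :=
  -- A nondegenerate interval is convex with nonempty interior, so derivatives within it are unique,
  -- also at its end points.
  hα.comp (uniqueDiffOn_convex hS.convex
    (hS.convex.nontrivial_iff_nonempty_interior.1 hS')) iso hol
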